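/- **Setting.** Consider a linear Arrow–Debreu market with agents $b_1,\dots,b_n$ and goods $g_1,\dots,g_n$, where $b_i$ owns one unit of $g_i$ (and nothing else) and $u_{ij}\ge 0$ is the utility of a unit of $g_j$ for $b_i$. For a price vector $p>0$, the equality network $N_p$ has the edges $(b_i,g_j)$ with $u_{ij}/p_j=\max_k u_{ik}/p_k$. A flow is $f=(f_{ij})\ge 0$ supported on these edges with $\sum_j f_{ij}\le p_i$ for all $i$ and $\sum_i f_{ij}\le p_j$ for all $j$. The surplus of $b_i$ is $r_f(b_i)=p_i-\sum_j f_{ij}$, and a flow is balanced if it minimizes $\|r_f\|_2$. For a set $S$ of agents, $\Gamma(S)$ is the set of goods adjacent in $N_p$ to an agent of $S$. **The algorithms.** The Duan–Mehlhorn (DM) and the Duan–Garg–Mehlhorn (DGM) algorithm start with $p=(1,\dots,1)$. As long as $\|r_f\|_2>\varepsilon$, where $f$ is a balanced flow in $N_p$, they perform an iteration: determine the set $S$ of high-surplus agents and multiply the prices of all goods in $\Gamma(S)$ by $x=\min(x_{\rm eq},x_{23},x_{24},x_{13},x_2,x_{\max})$. *The set $S$.* Sort the agents by decreasing surplus, $r(1)\ge\dots\ge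 r(n)$; then $S$ consists of the first $\ell$ agents. In DM, $\ell<n$ is minimal with $r(\ell)>(1+\frac1n)r(\ell+1)$. In DGM, $\ell<n$ is minimal such that $r(\ell)>r(\ell+1)$ and every agent with surplus in $[r(\ell)/(1+\frac1n),r(\ell))$ has no outflow and owns no good in $\Gamma(S)$. If there is no such $\ell$, then $\ell=n$. *The factor $x$.* Put $a_i=p_i$ if $g_i\in\Gamma(S)$ and $a_i=0$ otherwise. An agent $b_i\in S$ is of type 1 if $a_i>\sum_{g_j\in\Gamma(S)}f_{ij}$ and of type 2 otherwise. An agent $b_i\notin S$ is of type 3 if $g_i\in\Gamma(S)$; it is of type 4b if $g_i\notin\Gamma(S)$ and $r_f(b_i)<\min_{b\in S}r_f(b)/(1+\frac1n)$. The factor $x_{\rm eq}$ is the minimum of $\frac{u_{ij}}{p_j}\cdot\frac{p_k}{u_{ik}}$ over $b_i\in S$, $(b_i,g_j)\in N_p$, $g_k\notin\Gamma(S)$, $u_{ik}>0$. When the prices of the goods in $\Gamma(S)$ and the flow into them are multiplied by $x$, the surpluses change; $x_{23}$, $x_{24}$, $x_{13}$ are the minimal $x>1$ at which a type-2 and a type-3,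 a type-2 and a type-4b, a type-1 and a type-3 agent, respectively, have equal surplus, and $x_2$ is the minimal $x>1$ at which a type-2 agent has surplus zero. (A minimum over the empty set is $\infty$.) With $R=8e^2$: in DM, $x_{\max}=1+\frac1{Rn^3}$; in DGM, $x_{\max}=1+\frac1{Rn^3}$ if there are type-3 agents, and $x_{\max}=1+\frac1{Rkn^2}$ otherwise, where $k$ is the number of type-1 agents. **The instance $I_n$** ($n$ even, $U\ge1$ an integer): $u_{1,1}=u_{1,2}=U$; $u_{i,i-1}=U$ for $2\le i\le n$; $u_{i,i+1}=1$ for $2\le i\le n-1$; all other $u_{ij}$ are $0$. **Theorem.** On $I_n$ both algorithms perform $\Omega(n^4\log U)$ iterations. Precisely, there is an absolute constant $c>0$ such that for all even $n\ge4$, all integers $U\ge1$, every stopping threshold $0<\varepsilon\le\frac{1}{8n^{4n}U^{3n}}$, and each of the two algorithms: the algorithm can be run on $I_n$ until it stops, and whenever it stops (whatever balanced flows are chosen), the number $T$ of iterations performed satisfies $$T\ \ge\ c\,n^4\log U .$$ In particular, if $U\ge 2$, then $T\ge c\,\dfrac{n^4\log(nU)}{\log n}$, so an iteration bound of $O(n^4\log(nU))$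 for DGM cannot be improved by more than a factor of order $\log n$. -/

import Mathlib

/-!
Linear Arrow–Debreu markets with `n` agents and `n` goods in which agent `i` owns exactly one unit of
good `i`; `u i j` is the utility of one unit of good `j` for agent `i`, and `p j` is the price of
good `j`.  Hence `p i` is both the price of good `i` and the budget of agent `i`.
-/

namespace ArrowDebreu

/-- The two algorithms: Duan–Mehlhorn and Duan–Garg–Mehlhorn. -/
inductive Algorithm
  | DM
  | DGM

section

variable {n : ℕ}

/-- The edge from agent `i` to good `j` is in the equality network of `p`: good `j` has the maximum
bang-for-buck ratio for agent `i`. -/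
def IsEdge (u : Fin n → Fin n → ℝ) (p : Fin n → ℝ) (i j : Fin n) : Prop :=
  ∀ k, u i k / p k ≤ u i j / p j

/-- A valid flow in the equality network, given by its values `f i j` on the edges from agents to
goods. By flow conservation the flow on the edge from the source to agent `i` is `∑ j, f i j`, and
the flow on the edge from good `j` to the sink is `∑ i, f i j`; both have the capacity given by the
price. -/
structure IsFlow (u : Fin n → Fin n → ℝ) (p : Fin n → ℝ) (f : Fin n → Fin n → ℝ) : Prop where
  nonneg : ∀ i j, 0 ≤ f i j
  supported : ∀ i j, f i j ≠ 0 → IsEdge u p i j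
  source_le : ∀ i, ∑ j, f i j ≤ p i
  sink_le : ∀ j, ∑ i, f i j ≤ p j

/-- The surplus of agent `i`: budget minus outflow. -/
def surplus (p : Fin n → ℝ) (f : Fin n → Fin n → ℝ) (i : Fin n) : ℝ :=
  p i - ∑ j, f i j

/-- The Euclidean norm of the surplus vector. -/
noncomputable def surplusNorm (p : Fin n → ℝ) (f : Fin n → Fin n → ℝ) : ℝ :=
  Real.sqrt (∑ i, surplus p f i ^ 2)

/-- A balanced flow: a valid flow whose surplus vector has minimum Euclidean norm. -/
def IsBalancedFlow (u : Fin n → Fin n → ℝ) (p : Fin n → ℝ) (f : Fin n → Fin n → ℝ) : Prop :=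
  IsFlow u p f ∧ ∀ g, IsFlow u p g → surplusNorm p f ≤ surplusNorm p g

open Classical in
/-- `Γ(S)`: the goods adjacent in the equality network to some agent of `S`. -/
noncomputable def nbhd (u : Fin n → Fin n → ℝ) (p : Fin n → ℝ) (S : Finset (Fin n)) :
    Finset (Fin n) :=
  Finset.univ.filter fun j => ∃ i ∈ S, IsEdge u p i j

/-- The agents whose surplus is at least `θ`. If the agents are sorted by decreasing surplus and
`b_ℓ` has strictly larger surplus than `b_{ℓ+1}`, then this is `{b_1, …, b_ℓ}` for `θ` the
surplus of `b_ℓ`. -/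
noncomputable def topAgents (p : Fin n → ℝ) (f : Fin n → Fin n → ℝ) (θ : ℝ) : Finset (Fin n) :=
  Finset.univ.filter fun i => θ ≤ surplus p f i

/-- `θ` is the surplus of an agent `b_ℓ` after which the sorted list of agents may be cut.
* `DM`: the surplus of `b_ℓ` is more than `1 + 1/n` times the surplus of `b_{ℓ+1}`, and thus more
  than `1 + 1/n` times that of every agent of smaller surplus.
* `DGM`: the surplus of `b_ℓ` is larger than that of `b_{ℓ+1}`, and every agent whose surplus is in
  `[θ/(1 + 1/n), θ)` has no outflow and owns no good of `Γ({b_1, …, b_ℓ})`. -/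
def IsCut (A : Algorithm) (u : Fin n → Fin n → ℝ) (p : Fin n → ℝ) (f : Fin n → Fin n → ℝ)
    (θ : ℝ) : Prop :=
  (∃ i, surplus p f i = θ) ∧ (∃ i, surplus p f i < θ) ∧
    match A with
    | .DM => ∀ k, surplus p f k < θ → (1 + 1 / (n : ℝ)) * surplus p f k < θ
    | .DGM => ∀ k, surplus p f k < θ → θ / (1 + 1 / (n : ℝ)) ≤ surplus p f k →
        ∑ j, f k j = 0 ∧ k ∉ nbhd u p (topAgents p f θ)

/-- `S` is the set of high-surplus agents: the shortest prefix of the sorted list of agents at which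
the list may be cut, or the set of all agents if there is none. -/
def IsHighSurplusSet (A : Algorithm) (u : Fin n → Fin n → ℝ) (p : Fin n → ℝ)
    (f : Fin n → Fin n → ℝ) (S : Finset (Fin n)) : Prop :=
  (∃ θ, IsGreatest {t | IsCut A u p f t} θ ∧ S = topAgents p f θ) ∨
    ((∀ θ, ¬ IsCut A u p f θ) ∧ S = Finset.univ)

/-- The prices after those of the goods in `G` are multiplied by `x`. -/
def newPrice (G : Finset (Fin n)) (x : ℝ) (p : Fin n → ℝ) (j : Fin n) : ℝ :=
  if j ∈ G then x * p j else p j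

/-- The flow after the flow into the goods in `G` is multiplied by `x`. -/
def newFlow (G : Finset (Fin n)) (x : ℝ) (f : Fin n → Fin n → ℝ) (i j : Fin n) : ℝ :=
  if j ∈ G then x * f i j else f i j

/-- The surplus of agent `i` after prices of the goods in `G` and flow into them are multiplied
by `x`. -/
def newSurplus (G : Finset (Fin n)) (p : Fin n → ℝ) (f : Fin n → Fin n → ℝ) (x : ℝ) (i : Fin n) :
    ℝ :=
  surplus (newPrice G x p) (newFlow G x f) i

/-- The total price of the goods of `G` owned by agent `i`. -/
def ownedValue (G : Finset (Fin n)) (p : Fin n → ℝ) (i : Fin n) : ℝ :=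
  if i ∈ G then p i else 0

/-- Type-1 agents: in `S`, and the surplus increases with the prices of the goods in `Γ(S)`. -/
def IsType1 (u : Fin n → Fin n → ℝ) (p : Fin n → ℝ) (f : Fin n → Fin n → ℝ)
    (S : Finset (Fin n)) (i : Fin n) : Prop :=
  i ∈ S ∧ ∑ j ∈ nbhd u p S, f i j < ownedValue (nbhd u p S) p i

/-- Type-2 agents: in `S`, and the surplus does not increase. -/
def IsType2 (u : Fin n → Fin n → ℝ) (p : Fin n → ℝ) (f : Fin n → Fin n → ℝ)
    (S : Finset (Fin n)) (i : Fin n) : Prop :=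
  i ∈ S ∧ ownedValue (nbhd u p S) p i ≤ ∑ j ∈ nbhd u p S, f i j

/-- Type-3 agents: not in `S`, and owning a good of `Γ(S)`. -/
def IsType3 (u : Fin n → Fin n → ℝ) (p : Fin n → ℝ) (S : Finset (Fin n)) (i : Fin n) : Prop :=
  i ∉ S ∧ i ∈ nbhd u p S

/-- Type-4b agents: not in `S`, owning no good of `Γ(S)`, and with surplus less than `1/(1 + 1/n)`
times the minimum surplus in `S`. -/
def IsType4b (u : Fin n → Fin n → ℝ) (p : Fin n → ℝ) (f : Fin n → Fin n → ℝ)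
    (S : Finset (Fin n)) (i : Fin n) : Prop :=
  i ∉ S ∧ i ∉ nbhd u p S ∧ ∀ s ∈ S, surplus p f i < surplus p f s / (1 + 1 / (n : ℝ))

/-- The constant `R = 8e²`. -/
noncomputable def R : ℝ := 8 * Real.exp 1 ^ 2

open Classical in
/-- The maximum price update factor `x_max`. -/
noncomputable def xMax (A : Algorithm) (u : Fin n → Fin n → ℝ) (p : Fin n → ℝ)
    (f : Fin n → Fin n → ℝ) (S : Finset (Fin n)) : ℝ :=
  match A with
  | .DM => 1 + 1 / (R * (n : ℝ) ^ 3)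
  | .DGM =>
      if ∃ i, IsType3 u p S i then 1 + 1 / (R * (n : ℝ) ^ 3)
      else 1 + 1 / (R * ((Finset.univ.filter fun i => IsType1 u p f S i).card : ℝ) * (n : ℝ) ^ 2)

/-- The candidates for the price update factor; their minimum is
`min (x_eq, x_23, x_24, x_13, x_2, x_max)`. The disjuncts after the first one are, in this order:
a new equality edge appears; a type-2 and a type-3, a type-2 and a type-4b, a type-1 and a type-3
agent get equal surplus; the surplus of a type-2 agent becomes zero. -/
def IsCandidateFactor (A : Algorithm) (u : Fin n → Fin n → ℝ) (p : Fin n → ℝ)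
    (f : Fin n → Fin n → ℝ) (S : Finset (Fin n)) (x : ℝ) : Prop :=
  x = xMax A u p f S ∨
  (∃ i ∈ S, ∃ j k, IsEdge u p i j ∧ k ∉ nbhd u p S ∧ 0 < u i k ∧
    x = u i j / p j * (p k / u i k)) ∨
  (1 < x ∧
    ((∃ i j, IsType2 u p f S i ∧ IsType3 u p S j ∧
        newSurplus (nbhd u p S) p f x i = newSurplus (nbhd u p S) p f x j) ∨
      (∃ i j, IsType2 u p f S i ∧ IsType4b u p f S j ∧
        newSurplus (nbhd u p S) p f x i = newSurplus (nbhd u p S) p f x j) ∨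
      (∃ i j, IsType1 u p f S i ∧ IsType3 u p S j ∧
        newSurplus (nbhd u p S) p f x i = newSurplus (nbhd u p S) p f x j) ∨
      (∃ i, IsType2 u p f S i ∧ newSurplus (nbhd u p S) p f x i = 0)))

/-- `Reaches A u ε t p`: algorithm `A` with stopping threshold `ε`, started with all prices equal to
one on the market with utilities `u`, can perform `t` iterations of its main loop and then has the
prices `p`. -/
inductive Reaches (A : Algorithm) (u : Fin n → Fin n → ℝ) (ε : ℝ) : ℕ → (Fin n → ℝ) → Prop
  | init : Reaches A u ε 0 (fun _ => 1)
  | iterate {t : ℕ} {p : Fin n → ℝ} (h : Reaches A u ε t p) (f : Fin n → Fin n → ℝ)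
      (S : Finset (Fin n)) (x : ℝ) (hf : IsBalancedFlow u p f) (guard : ε < surplusNorm p f)
      (hS : IsHighSurplusSet A u p f S) (hx : IsLeast {y | IsCandidateFactor A u p f S y} x) :
      Reaches A u ε (t + 1) (newPrice (nbhd u p S) x p)

/-- The main loop of algorithm `A` ends after exactly `T` iterations (in some execution; executions
can differ in the choice of the balanced flows). -/
def HaltsAfter (A : Algorithm) (u : Fin n → Fin n → ℝ) (ε : ℝ) (T : ℕ) : Prop :=
  ∃ p f, Reaches A u ε T p ∧ IsBalancedFlow u p f ∧ surplusNorm p f ≤ ε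

end

/-- The utilities of the instance `I_n`, with agents and goods numbered from zero: agent `0` has
utility `U` for the goods `0` and `1`; agent `i ≥ 1` has utility `U` for good `i - 1` and utility `1`
for good `i + 1` (if that exists); all other utilities are zero. -/
def instanceI (n U : ℕ) (i j : Fin n) : ℝ :=
  if i.val = 0 then (if j.val ≤ 1 then (U : ℝ) else 0)
  else if j.val + 1 = i.val then (U : ℝ)
  else if j.val = i.val + 1 then 1
  else 0

end ArrowDebreu

/-!
On the instance `I_n` both algorithms can be simulated exactly; agents and goods are numbered from
zero. The run passes through phases `m = 1, …, n/2 - 1`. In phase `m` the prices are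
`phasePrice U m y` with `1 ≤ y < U`: each of the goods `2l` and `2l + 1` with `l < m` has price
`U ^ (m - 1 - l) * y`, and all other goods have price one.

The agents `0, …, 2m` can buy only the goods `0, …, 2m - 1`, and their joint budget exceeds the price
of these goods by exactly one (`one_le_sum_surplus`). The equality edges between them form a path
with an agent at either end, along which the surplus can be spread evenly (`phaseFlow`). Hence, by
convexity, in every balanced flow these agents have surplus `1 / (2m + 1)` each, and all other agents
have surplus zero (`IsBalancedFlow.surplus_eq`). So both algorithms choose `S = {0, …, 2m}`, with
`Γ(S) = {0, …, 2m - 1}`, there are `2m` agents of type 1, agent `2m` is the only one of type 2, and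
there are none of type 3. The price update factor is the minimum of `x_max` and `U / y`
(`isLeast_candidateFactor`), and the next prices have the same form, with `y` multiplied by this
factor. When `y` reaches `U`, new equality edges appear and phase `m + 1` begins with `y = 1`. At the
end of the last phase, `m = n/2` and `y = 1`, all agents can spend their budgets
(`exists_isFlow_final`). Before that, the norm of the surplus vector is at least `1 / n`, which is
more than `ε`, so the algorithms stop at these final prices and nowhere else.

In phase `m`, in either algorithm, `x_max ≤ 1 + 1 / (2 R m n²)`. Multiplying `y` by `U` therefore
takes at least `2 R m n² log U` iterations, and summing over the phases gives
`R n² (n/2) (n/2 - 1) log U` iterations, which is at least `e² n⁴ log U` for `n ≥ 4`. The potential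
`phaseProgress` does this bookkeeping.
-/

namespace ArrowDebreu

open Finset

/-! ### The prices of a phase -/

section Prices

/-- The prices in phase `m`, as a function of the number of the good: each of the goods `2l` and
`2l + 1` with `l < m` has price `U ^ (m - 1 - l) * y`, and all other goods still have price one.
During the phase, `y` grows from `1` to `U`. -/
def phasePrice (U m : ℕ) (y : ℝ) (j : ℕ) : ℝ :=
  if j < 2 * m then (U : ℝ) ^ (m - 1 - j / 2) * y else 1

variable {U m : ℕ} {y : ℝ}

lemma one_le_phasePrice (hU : 1 ≤ U) (hy : 1 ≤ y) (j : ℕ) : 1 ≤ phasePrice U m y j := by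
  unfold phasePrice
  split_ifs
  · exact one_le_mul_of_one_le_of_one_le (one_le_pow₀ (by exact_mod_cast hU)) hy
  · exact le_rfl

lemma phasePrice_pos (hU : 1 ≤ U) (hy : 1 ≤ y) (j : ℕ) : 0 < phasePrice U m y j :=
  one_pos.trans_le (one_le_phasePrice hU hy j)

lemma phasePrice_of_le {j : ℕ} (hj : 2 * m ≤ j) : phasePrice U m y j = 1 := by
  simp [phasePrice, hj.not_gt]

lemma phasePrice_two_mul_add_one (l : ℕ) :
    phasePrice U m y (2 * l + 1) = phasePrice U m y (2 * l) := by
  unfold phasePrice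
  have h : (2 * l + 1) / 2 = 2 * l / 2 := by omega
  rw [h]
  by_cases hl : l < m
  · rw [if_pos (by omega), if_pos (by omega)]
  · rw [if_neg (by omega), if_neg (by omega)]

lemma phasePrice_eq_mul {j : ℕ} (hj : j + 2 < 2 * m) :
    phasePrice U m y j = U * phasePrice U m y (j + 2) := by
  unfold phasePrice
  have h : m - 1 - j / 2 = (m - 1 - (j + 2) / 2) + 1 := by omega
  rw [if_pos (by omega), if_pos hj, h, pow_succ]
  ring

lemma phasePrice_of_last {j : ℕ} (hj : 2 * m ≤ j + 2) (hj' : j < 2 * m) :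
    phasePrice U m y j = y := by
  have h : m - 1 - j / 2 = 0 := by omega
  simp [phasePrice, hj', h]

lemma phasePrice_lt_mul {j : ℕ} (hy : 1 ≤ y) (hyU : y < U) (hj : 2 * m ≤ j + 2) :
    phasePrice U m y j < U * phasePrice U m y (j + 2) := by
  rw [phasePrice_of_le hj, mul_one]
  by_cases hj' : j < 2 * m
  · rwa [phasePrice_of_last hj hj']
  · rw [phasePrice_of_le (by omega)]
    linarith

lemma phasePrice_le_mul (hy : 1 ≤ y) (hyU : y ≤ U) (j : ℕ) :
    phasePrice U m y j ≤ U * phasePrice U m y (j + 2) := by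
  by_cases hj : j + 2 < 2 * m
  · exact (phasePrice_eq_mul hj).le
  · rw [phasePrice_of_le (by omega : 2 * m ≤ j + 2), mul_one]
    by_cases hj' : j < 2 * m
    · rwa [phasePrice_of_last (by omega) hj']
    · rw [phasePrice_of_le (by omega)]
      linarith

/-- The end of a phase is the beginning of the next one. -/
lemma phasePrice_succ (j : ℕ) : phasePrice U (m + 1) 1 j = phasePrice U m U j := by
  unfold phasePrice
  by_cases hj : j < 2 * m
  · have h : m + 1 - 1 - j / 2 = (m - 1 - j / 2) + 1 := by omega
    rw [if_pos (by omega), if_pos hj, h, pow_succ, mul_one]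
  · rw [if_neg hj]
    by_cases hj' : j < 2 * (m + 1)
    · rw [if_pos hj', show m + 1 - 1 - j / 2 = 0 by omega, pow_zero, mul_one]
    · rw [if_neg hj']

lemma phasePrice_one_one (j : ℕ) : phasePrice U 1 1 j = 1 := by
  simp [phasePrice]

end Prices

/-! ### The equality network of a phase -/

section Edges

variable {n U m : ℕ} {y : ℝ}

lemma instanceI_of_zero {i j : Fin n} (hi : i.val = 0) (hj : j.val ≤ 1) :
    instanceI n U i j = U := by
  simp [instanceI, hi, hj]

lemma instanceI_pred {i j : Fin n} (h : j.val + 1 = i.val) : instanceI n U i j = U := by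
  have : i.val ≠ 0 := by omega
  simp [instanceI, this, h]

lemma instanceI_succ {i j : Fin n} (hi : i.val ≠ 0) (h : j.val = i.val + 1) :
    instanceI n U i j = 1 := by
  have : j.val + 1 ≠ i.val := by omega
  rw [instanceI, if_neg hi, if_neg this, if_pos h]

lemma instanceI_pos_cases {i j : Fin n} (h : 0 < instanceI n U i j) :
    (i.val = 0 ∧ j.val ≤ 1) ∨ j.val + 1 = i.val ∨ (i.val ≠ 0 ∧ j.val = i.val + 1) := by
  unfold instanceI at h
  split_ifs at h <;> first | omega | exact absurd h (lt_irrefl _)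

lemma instanceI_nonneg (i j : Fin n) : 0 ≤ instanceI n U i j := by
  unfold instanceI
  split_ifs <;> positivity

/-- To find the edges of the equality network, it suffices to look at the goods with positive
utility. -/
lemma isEdge_of_forall_pos {u : Fin n → Fin n → ℝ} {p : Fin n → ℝ} {i j : Fin n}
    (hu : ∀ k, 0 ≤ u i k) (hp : ∀ k, 0 < p k)
    (h : ∀ k, 0 < u i k → u i k / p k ≤ u i j / p j) : IsEdge u p i j := by
  intro k
  rcases (hu k).eq_or_lt with hk | hk
  · rw [← hk, zero_div]
    exact div_nonneg (hu j) (hp j).le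
  · exact h k hk

lemma isEdge_of_zero (hU : 1 ≤ U) (hy : 1 ≤ y) {i j : Fin n} (hi : i.val = 0) (hj : j.val ≤ 1) :
    IsEdge (instanceI n U) (fun k => phasePrice U m y k) i j := by
  refine isEdge_of_forall_pos (instanceI_nonneg i) (fun k => phasePrice_pos hU hy k) fun k hk => ?_
  have hk1 : k.val ≤ 1 := by rcases instanceI_pos_cases hk with h | h | h <;> omega
  have key : ∀ a : ℕ, a ≤ 1 → phasePrice U m y a = phasePrice U m y 0 := by
    intro a ha
    interval_cases a
    · rfl
    · exact phasePrice_two_mul_add_one 0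
  rw [instanceI_of_zero hi hj, instanceI_of_zero hi hk1, key _ hj, key _ hk1]

lemma isEdge_pred (hU : 1 ≤ U) (hy : 1 ≤ y) (hyU : y ≤ U) {i j : Fin n}
    (h : j.val + 1 = i.val) :
    IsEdge (instanceI n U) (fun k => phasePrice U m y k) i j := by
  refine isEdge_of_forall_pos (instanceI_nonneg i) (fun k => phasePrice_pos hU hy k) fun k hk => ?_
  rw [instanceI_pred h]
  rcases instanceI_pos_cases hk with h' | h' | h'
  · omega
  · rw [instanceI_pred h', show k = j from Fin.ext (by omega)]
  · rw [instanceI_succ h'.1 h'.2, div_le_div_iff₀ (phasePrice_pos hU hy _) (phasePrice_pos hU hy _),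
      one_mul, show k.val = j.val + 2 by omega]
    exact phasePrice_le_mul hy hyU _

lemma isEdge_succ (hU : 1 ≤ U) (hy : 1 ≤ y) {i j : Fin n} (hi : i.val ≠ 0)
    (h : j.val = i.val + 1) (hj : j.val < 2 * m) :
    IsEdge (instanceI n U) (fun k => phasePrice U m y k) i j := by
  refine isEdge_of_forall_pos (instanceI_nonneg i) (fun k => phasePrice_pos hU hy k) fun k hk => ?_
  rw [instanceI_succ hi h]
  rcases instanceI_pos_cases hk with h' | h' | h'
  · omega
  · rw [instanceI_pred h', div_le_div_iff₀ (phasePrice_pos hU hy _) (phasePrice_pos hU hy _),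
      one_mul, show j.val = k.val + 2 by omega]
    exact (phasePrice_eq_mul (by omega)).ge
  · rw [instanceI_succ h'.1 h'.2, show k = j from Fin.ext (by omega)]

lemma IsEdge.cases (hn : 2 ≤ n) (hy : 1 ≤ y) (hyU : y < U) {i j : Fin n}
    (h : IsEdge (instanceI n U) (fun k => phasePrice U m y k) i j) :
    (i.val = 0 ∧ j.val ≤ 1) ∨ j.val + 1 = i.val ∨
      (i.val ≠ 0 ∧ j.val = i.val + 1 ∧ j.val < 2 * m) := by
  have hU : (0 : ℝ) < U := by linarith
  have hU' : 1 ≤ U := by exact_mod_cast hU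
  have hpos := fun a => phasePrice_pos (U := U) (m := m) (y := y) hU' hy a
  obtain ⟨k, hk⟩ : ∃ k : Fin n, k.val = i.val - 1 := ⟨⟨i.val - 1, by omega⟩, rfl⟩
  have hik : instanceI n U i k = U := by
    by_cases hi : i.val = 0
    · exact instanceI_of_zero hi (by omega)
    · exact instanceI_pred (by omega)
  have hle := h k
  simp only [hik] at hle
  have huj : 0 < instanceI n U i j := by
    have : 0 < instanceI n U i j / phasePrice U m y j := (div_pos hU (hpos k)).trans_le hle
    exact (div_pos_iff_of_pos_right (hpos j)).1 this
  rcases instanceI_pos_cases huj with h' | h' | h'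
  · exact Or.inl h'
  · exact Or.inr (Or.inl h')
  · refine Or.inr (Or.inr ⟨h'.1, h'.2, ?_⟩)
    by_contra hj
    rw [instanceI_succ h'.1 h'.2, div_le_div_iff₀ (hpos _) (hpos _), one_mul,
      show j.val = k.val + 2 by omega] at hle
    exact absurd (phasePrice_lt_mul hy hyU (by omega)) hle.not_gt

end Edges

/-! ### A flow with equal surpluses -/

section Flows

variable {n U m : ℕ} {y : ℝ}

/-- The agents `0, …, 2m`, which have positive surplus in phase `m`. -/
def phaseAgents (n m : ℕ) : Finset (Fin n) := univ.filter fun i => i.val ≤ 2 * m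

/-- The goods `0, …, 2m - 1`, whose prices are raised in phase `m`. -/
def phaseGoods (n m : ℕ) : Finset (Fin n) := univ.filter fun j => j.val < 2 * m

@[simp] lemma mem_phaseAgents {i : Fin n} : i ∈ phaseAgents n m ↔ i.val ≤ 2 * m := by
  simp [phaseAgents]

@[simp] lemma mem_phaseGoods {j : Fin n} : j ∈ phaseGoods n m ↔ j.val < 2 * m := by
  simp [phaseGoods]

lemma phaseAgents_eq_insert (h : 2 * m < n) :
    phaseAgents n m = insert ⟨2 * m, h⟩ (phaseGoods n m) := by
  ext i
  simp only [mem_phaseAgents, mem_insert, mem_phaseGoods, Fin.ext_iff]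
  omega

lemma card_phaseGoods (h : 2 * m < n) : (phaseGoods n m).card = 2 * m := by
  have : phaseGoods n m = Finset.Iio ⟨2 * m, h⟩ := by
    ext i
    simp [Fin.lt_def]
  rw [this, Fin.card_Iio]

lemma card_phaseAgents (h : 2 * m < n) : (phaseAgents n m).card = 2 * m + 1 := by
  rw [phaseAgents_eq_insert h, card_insert_of_notMem (by simp), card_phaseGoods h]

/-- The network in which agent `i` sends `b i` to good `i - 1` (agent `0` to good `0`) and `c i` to
good `i + 1`. -/
def pathFlow (n : ℕ) (b c : ℕ → ℝ) (i j : Fin n) : ℝ :=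
  (if j.val = i.val - 1 then b i else 0) + if j.val = i.val + 1 then c i else 0

lemma sum_fin_ite_val_eq (a : ℕ) (g : ℕ → ℝ) :
    ∑ j : Fin n, (if j.val = a then g j.val else 0) = if a < n then g a else 0 := by
  rw [Fin.sum_univ_eq_sum_range (fun j => if j = a then g j else 0) n]
  simp

lemma sum_pathFlow_row (b c : ℕ → ℝ) (i : Fin n) :
    ∑ j, pathFlow n b c i j = b i + if i.val + 1 < n then c i else 0 := by
  unfold pathFlow
  rw [sum_add_distrib, sum_fin_ite_val_eq _ (fun _ => b i), sum_fin_ite_val_eq _ (fun _ => c i),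
    if_pos (by omega : i.val - 1 < n)]

lemma sum_pathFlow_col (b c : ℕ → ℝ) (j : Fin n) :
    ∑ i, pathFlow n b c i j =
      (if j.val + 1 < n then b (j + 1) else 0) + if j.val = 0 then b 0 else c (j - 1) := by
  have h : ∀ i : Fin n, pathFlow n b c i j =
      (if i.val = j.val + 1 then b i else 0) +
        if i.val = j.val - 1 then (if j.val = 0 then b i else c i) else 0 := by
    intro i
    unfold pathFlow
    rcases Nat.eq_zero_or_pos j.val with hj | hj <;>
    rcases Nat.eq_zero_or_pos i.val with hi | hi
    · simp [hi, hj]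
    · simp only [hj, if_true]
      rw [if_neg (by omega : ¬ (0 = i.val + 1)), if_neg (by omega : ¬ (i.val = 0 - 1)),
        if_congr (by omega : 0 = i.val - 1 ↔ i.val = 0 + 1) rfl rfl]
    · rw [if_neg (by omega : ¬ (j.val = i.val - 1)), if_neg (by omega : ¬ (i.val = j.val + 1)),
        if_congr (by omega : j.val = i.val + 1 ↔ i.val = j.val - 1) rfl rfl,
        if_neg (by omega : ¬ j.val = 0)]
    · rw [if_congr (by omega : j.val = i.val + 1 ↔ i.val = j.val - 1) rfl rfl,
        if_congr (by omega : j.val = i.val - 1 ↔ i.val = j.val + 1) rfl rfl,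
        if_neg (by omega : ¬ j.val = 0)]
  rw [sum_congr rfl fun i _ => h i, sum_add_distrib, sum_fin_ite_val_eq _ b,
    sum_fin_ite_val_eq _ (fun i => if j.val = 0 then b i else c i),
    if_pos (by omega : j.val - 1 < n)]
  by_cases hj : j.val = 0 <;> simp [hj]

/-- The flow of agent `i` into good `i - 1` (good `0` for `i = 0`) in phase `m`. The values are
forced by the requirements that the goods `0, …, 2m - 1` are sold out and that each of the agents
`0, …, 2m` keeps a surplus of `1 / (2m + 1)`: start at an
end of the path formed by the equality edges and proceed along it. -/
noncomputable def backFlow (U m : ℕ) (y : ℝ) (i : ℕ) : ℝ :=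
  if 2 * m < i then 1
  else if i % 2 = 0 then ((m : ℝ) + (i / 2 : ℕ)) / (2 * m + 1)
  else phasePrice U m y i - ((m : ℝ) - (i / 2 : ℕ)) / (2 * m + 1)

/-- The flow of agent `i` into good `i + 1` in phase `m`. -/
noncomputable def forwardFlow (U m : ℕ) (y : ℝ) (i : ℕ) : ℝ :=
  if 2 * m < i then 0
  else if i % 2 = 0 then phasePrice U m y i - ((m : ℝ) + (i / 2 : ℕ) + 1) / (2 * m + 1)
  else ((m : ℝ) - (i / 2 : ℕ) - 1) / (2 * m + 1)

lemma backFlow_nonneg (hU : 1 ≤ U) (hy : 1 ≤ y) (i : ℕ) : 0 ≤ backFlow U m y i := by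
  unfold backFlow
  split_ifs with h h'
  · exact zero_le_one
  · positivity
  · have h1 := one_le_phasePrice (m := m) hU hy i
    have h2 : ((m : ℝ) - (i / 2 : ℕ)) / (2 * m + 1) ≤ 1 := by
      rw [div_le_one (by positivity)]
      have : (0 : ℝ) ≤ (i / 2 : ℕ) := by positivity
      have : (0 : ℝ) ≤ m := by positivity
      linarith
    linarith

lemma forwardFlow_nonneg (hU : 1 ≤ U) (hy : 1 ≤ y) (i : ℕ) : 0 ≤ forwardFlow U m y i := by
  unfold forwardFlow
  split_ifs with h h'
  · exact le_rfl
  · have h1 := one_le_phasePrice (m := m) hU hy i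
    have h2 : ((m : ℝ) + (i / 2 : ℕ) + 1) / (2 * m + 1) ≤ 1 := by
      rw [div_le_one (by positivity)]
      have : ((i / 2 : ℕ) : ℝ) ≤ m := by exact_mod_cast (by omega : i / 2 ≤ m)
      linarith
    linarith
  · have : ((i / 2 : ℕ) : ℝ) + 1 ≤ m := by exact_mod_cast (by omega : i / 2 + 1 ≤ m)
    exact div_nonneg (by linarith) (by positivity)

/-- Beyond the goods of phase `m` no flow goes forward. -/
lemma forwardFlow_eq_zero {i : ℕ} (h : 2 * m ≤ i + 1) : forwardFlow U m y i = 0 := by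
  have hpos : (2 * (m : ℝ) + 1) ≠ 0 := by positivity
  unfold forwardFlow
  split_ifs with h1 h2
  · rfl
  · obtain rfl : i = 2 * m := by omega
    rw [phasePrice_of_le le_rfl, Nat.mul_div_cancel_left _ two_pos]
    field_simp
    ring
  · have : (m : ℝ) = (i / 2 : ℕ) + 1 := by exact_mod_cast (by omega : m = i / 2 + 1)
    rw [this]
    simp

lemma backFlow_add_forwardFlow (i : ℕ) : backFlow U m y i + forwardFlow U m y i =
    phasePrice U m y i - if i ≤ 2 * m then 1 / (2 * (m : ℝ) + 1) else 0 := by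
  unfold backFlow forwardFlow
  by_cases h : 2 * m < i
  · rw [if_pos h, if_pos h, if_neg (by omega), phasePrice_of_le h.le]
    ring
  · rw [if_neg h, if_neg h, if_pos (by omega : i ≤ 2 * m)]
    split_ifs <;> ring

lemma backFlow_succ_add_forwardFlow_pred {j : ℕ} (hj : j ≠ 0) :
    backFlow U m y (j + 1) + forwardFlow U m y (j - 1) = phasePrice U m y j := by
  by_cases h : 2 * m < j + 1
  · rw [forwardFlow_eq_zero (by omega), phasePrice_of_le (by omega), backFlow, if_pos h, add_zero]
  · unfold backFlow forwardFlow
    rw [if_neg h, if_neg (by omega : ¬ 2 * m < j - 1)]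
    rcases Nat.even_or_odd' j with ⟨l, rfl | rfl⟩
    · rw [if_neg (by omega), if_neg (by omega), phasePrice_two_mul_add_one,
        show (2 * l + 1) / 2 = l by omega, show (2 * l - 1) / 2 = l - 1 by omega,
        Nat.cast_sub (by omega)]
      push_cast
      ring
    · rw [if_pos (by omega), if_pos (by omega), show (2 * l + 1 + 1) / 2 = l + 1 by omega,
        show 2 * l + 1 - 1 = 2 * l by omega, show 2 * l / 2 = l by omega,
        phasePrice_two_mul_add_one]
      push_cast
      ring

lemma backFlow_one_add_backFlow_zero (hm : 1 ≤ m) :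
    backFlow U m y 1 + backFlow U m y 0 = phasePrice U m y 0 := by
  have h : phasePrice U m y 1 = phasePrice U m y 0 := phasePrice_two_mul_add_one 0
  unfold backFlow
  rw [if_neg (by omega), if_neg (by omega), if_neg (by omega), if_pos rfl, h]
  simp

/-- The flow with `backFlow` and `forwardFlow`: the agents `0, …, 2m` keep a surplus of
`1 / (2m + 1)` each and buy the goods `0, …, 2m - 1`; every other agent `i` buys good `i - 1`. -/
noncomputable def phaseFlow (n U m : ℕ) (y : ℝ) : Fin n → Fin n → ℝ :=
  pathFlow n (backFlow U m y) (forwardFlow U m y)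

lemma surplus_phaseFlow (hmn : 2 * m + 2 ≤ n) (i : Fin n) :
    surplus (fun k => phasePrice U m y k) (phaseFlow n U m y) i =
      if i.val ≤ 2 * m then 1 / (2 * (m : ℝ) + 1) else 0 := by
  have h : (if i.val + 1 < n then forwardFlow U m y i else 0) = forwardFlow U m y i := by
    split_ifs
    · rfl
    · rw [forwardFlow_eq_zero (by omega)]
  rw [surplus, phaseFlow, sum_pathFlow_row, h, backFlow_add_forwardFlow]
  ring

lemma isFlow_phaseFlow (hU : 1 ≤ U) (hy : 1 ≤ y) (hyU : y ≤ U) (hm : 1 ≤ m)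
    (hmn : 2 * m + 2 ≤ n) :
    IsFlow (instanceI n U) (fun k => phasePrice U m y k) (phaseFlow n U m y) where
  nonneg i j := by
    have h1 := backFlow_nonneg (m := m) hU hy i
    have h2 := forwardFlow_nonneg (m := m) hU hy i
    unfold phaseFlow pathFlow
    split_ifs <;> linarith
  supported i j hij := by
    unfold phaseFlow pathFlow at hij
    by_cases h1 : j.val = i.val - 1
    · by_cases hi : i.val = 0
      · exact isEdge_of_zero hU hy hi (by omega)
      · exact isEdge_pred hU hy hyU (by omega)
    · by_cases h2 : j.val = i.val + 1
      · by_cases hi : i.val = 0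
        · exact isEdge_of_zero hU hy hi (by omega)
        · refine isEdge_succ hU hy hi h2 ?_
          by_contra h3
          rw [if_neg h1, if_pos h2, forwardFlow_eq_zero (by omega), add_zero] at hij
          exact hij rfl
      · rw [if_neg h1, if_neg h2, add_zero] at hij
        exact absurd rfl hij
  source_le i := by
    have h := surplus_phaseFlow (U := U) (y := y) hmn i
    have h' : (0 : ℝ) ≤ if i.val ≤ 2 * m then 1 / (2 * (m : ℝ) + 1) else 0 := by
      split_ifs <;> positivity
    rw [← h, surplus] at h'
    linarith
  sink_le j := by
    rw [phaseFlow, sum_pathFlow_col]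
    have hb := backFlow_nonneg (m := m) hU hy (j + 1)
    have hle : (if j.val + 1 < n then backFlow U m y (j + 1) else 0) ≤ backFlow U m y (j + 1) := by
      split_ifs <;> linarith
    by_cases hj : j.val = 0
    · rw [if_pos hj]
      refine (add_le_add_left hle _).trans ?_
      rw [hj]
      exact (backFlow_one_add_backFlow_zero hm).le
    · rw [if_neg hj]
      exact (add_le_add_left hle _).trans (backFlow_succ_add_forwardFlow_pred hj).le

end Flows

/-! ### Surpluses of balanced flows -/

section BalancedFlows

variable {n U m : ℕ} {y : ℝ}

/-- Among the vectors whose sum over the `N` elements of `S` is at least one, the vector that is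
`1 / N` on `S` and zero elsewhere is the only one of minimum norm; this identity shows it. -/
lemma sum_sq_sub_indicator {ι : Type*} [Fintype ι] [DecidableEq ι] (r : ι → ℝ) (S : Finset ι)
    {N : ℝ} (hN : (S.card : ℝ) = N) (hpos : 0 < N) :
    ∑ i, (r i - if i ∈ S then 1 / N else 0) ^ 2 =
      ∑ i, r i ^ 2 - 2 / N * ∑ i ∈ S, r i + 1 / N := by
  have h : ∀ i, (r i - if i ∈ S then 1 / N else 0) ^ 2 =
      r i ^ 2 - (if i ∈ S then 2 / N * r i else 0) + if i ∈ S then (1 / N) ^ 2 else 0 := by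
    intro i
    split_ifs <;> ring
  rw [sum_congr rfl fun i _ => h i, sum_add_distrib, sum_sub_distrib, sum_ite_mem, sum_ite_mem,
    univ_inter, sum_const, nsmul_eq_mul, hN, ← mul_sum]
  field_simp

lemma IsEdge.lt_of_le (hn : 2 ≤ n) (hm : 1 ≤ m) (hy : 1 ≤ y) (hyU : y < U) {i j : Fin n}
    (h : IsEdge (instanceI n U) (fun k => phasePrice U m y k) i j) (hi : i.val ≤ 2 * m) :
    j.val < 2 * m := by
  rcases h.cases hn hy hyU with h | h | h <;> omega

lemma IsEdge.le_of_lt (hn : 2 ≤ n) (hy : 1 ≤ y) (hyU : y < U) {i j : Fin n}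
    (h : IsEdge (instanceI n U) (fun k => phasePrice U m y k) i j) (hi : 2 * m < i.val) :
    2 * m ≤ j.val := by
  rcases h.cases hn hy hyU with h | h | h <;> omega

lemma nbhd_phaseAgents (hU : 1 ≤ U) (hm : 1 ≤ m) (hmn : 2 * m + 2 ≤ n) (hy : 1 ≤ y)
    (hyU : y < U) :
    nbhd (instanceI n U) (fun k => phasePrice U m y k) (phaseAgents n m) = phaseGoods n m := by
  ext j
  simp only [nbhd, mem_filter, mem_univ, true_and, mem_phaseAgents, mem_phaseGoods]
  constructor
  · rintro ⟨i, hi, h⟩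
    exact h.lt_of_le (by omega) hm hy hyU hi
  · intro hj
    exact ⟨⟨j.val + 1, by omega⟩, by simp only; omega, isEdge_pred hU hy hyU.le rfl⟩

lemma sum_phaseGoods_of_isFlow (hm : 1 ≤ m) (hmn : 2 * m + 2 ≤ n)
    (hy : 1 ≤ y) (hyU : y < U) (hf : IsFlow (instanceI n U) (fun k => phasePrice U m y k) f)
    {i : Fin n} (hi : i.val ≤ 2 * m) : ∑ j ∈ phaseGoods n m, f i j = ∑ j, f i j := by
  refine sum_subset (subset_univ _) fun j _ hj => ?_
  by_contra hne
  exact hj (mem_phaseGoods.2 ((hf.supported i j hne).lt_of_le (by omega) hm hy hyU hi))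

/-- The agents `0, …, 2m` can only buy the goods `0, …, 2m - 1`, which are cheaper by one than their
joint budget. -/
lemma one_le_sum_surplus (hm : 1 ≤ m) (hmn : 2 * m + 2 ≤ n) (hy : 1 ≤ y)
    (hyU : y < U) {f : Fin n → Fin n → ℝ}
    (hf : IsFlow (instanceI n U) (fun k => phasePrice U m y k) f) :
    1 ≤ ∑ i ∈ phaseAgents n m, surplus (fun k => phasePrice U m y k) f i := by
  have h1 : ∀ i ∈ phaseAgents n m, ∑ j, f i j = ∑ j ∈ phaseGoods n m, f i j := fun i hi =>
    (sum_phaseGoods_of_isFlow hm hmn hy hyU hf (mem_phaseAgents.1 hi)).symm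
  have h2 : ∑ i ∈ phaseAgents n m, ∑ j ∈ phaseGoods n m, f i j ≤
      ∑ j ∈ phaseGoods n m, phasePrice U m y j := by
    rw [sum_comm]
    refine sum_le_sum fun j _ => le_trans ?_ (hf.sink_le j)
    exact sum_le_sum_of_subset_of_nonneg (subset_univ _) fun i _ _ => hf.nonneg i j
  have h3 : ∑ i ∈ phaseAgents n m, phasePrice U m y i =
      1 + ∑ j ∈ phaseGoods n m, phasePrice U m y j := by
    rw [phaseAgents_eq_insert (by omega), sum_insert (by simp), phasePrice_of_le le_rfl]
  simp only [surplus]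
  rw [sum_sub_distrib, h3, sum_congr rfl h1]
  linarith

lemma sum_sq_surplus_phaseFlow (hmn : 2 * m + 2 ≤ n) :
    ∑ i, surplus (fun k => phasePrice U m y k) (phaseFlow n U m y) i ^ 2 =
      1 / (2 * (m : ℝ) + 1) := by
  have h : ∀ i : Fin n, surplus (fun k => phasePrice U m y k) (phaseFlow n U m y) i ^ 2 =
      if i ∈ phaseAgents n m then (1 / (2 * (m : ℝ) + 1)) ^ 2 else 0 := by
    intro i
    rw [surplus_phaseFlow hmn]
    simp only [mem_phaseAgents]
    split_ifs <;> ring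
  rw [sum_congr rfl fun i _ => h i, sum_ite_mem, univ_inter, sum_const,
    card_phaseAgents (by omega), nsmul_eq_mul]
  push_cast
  field_simp

lemma card_phaseAgents_cast (h : 2 * m < n) : ((phaseAgents n m).card : ℝ) = 2 * m + 1 := by
  rw [card_phaseAgents h]
  push_cast
  ring

lemma isBalancedFlow_phaseFlow (hU : 1 ≤ U) (hm : 1 ≤ m) (hmn : 2 * m + 2 ≤ n) (hy : 1 ≤ y)
    (hyU : y < U) :
    IsBalancedFlow (instanceI n U) (fun k => phasePrice U m y k) (phaseFlow n U m y) := by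
  refine ⟨isFlow_phaseFlow hU hy hyU.le hm hmn, fun g hg => Real.sqrt_le_sqrt ?_⟩
  have hN : (0 : ℝ) < 2 * m + 1 := by positivity
  have h1 := one_le_sum_surplus hm hmn hy hyU hg
  have h2 := sum_sq_sub_indicator (surplus (fun k => phasePrice U m y k) g) (phaseAgents n m)
    (card_phaseAgents_cast (by omega)) hN
  have h3 : 0 ≤ ∑ i, (surplus (fun k => phasePrice U m y k) g i -
      if i ∈ phaseAgents n m then 1 / (2 * (m : ℝ) + 1) else 0) ^ 2 :=
    sum_nonneg fun i _ => sq_nonneg _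
  have h4 := mul_le_mul_of_nonneg_left h1 (by positivity : 0 ≤ 2 / (2 * (m : ℝ) + 1))
  have h5 : 2 / (2 * (m : ℝ) + 1) = 2 * (1 / (2 * (m : ℝ) + 1)) := by ring
  rw [sum_sq_surplus_phaseFlow hmn]
  rw [mul_one] at h4
  linarith

/-- All balanced flows of phase `m` have the same surpluses: the agents `0, …, 2m` share the total
surplus one equally. -/
lemma IsBalancedFlow.surplus_eq (hU : 1 ≤ U) (hm : 1 ≤ m) (hmn : 2 * m + 2 ≤ n) (hy : 1 ≤ y)
    (hyU : y < U) {f : Fin n → Fin n → ℝ}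
    (hf : IsBalancedFlow (instanceI n U) (fun k => phasePrice U m y k) f) (i : Fin n) :
    surplus (fun k => phasePrice U m y k) f i =
      if i.val ≤ 2 * m then 1 / (2 * (m : ℝ) + 1) else 0 := by
  have hN : (0 : ℝ) < 2 * m + 1 := by positivity
  have h1 := one_le_sum_surplus hm hmn hy hyU hf.1
  have h2 := sum_sq_sub_indicator (surplus (fun k => phasePrice U m y k) f) (phaseAgents n m)
    (card_phaseAgents_cast (by omega)) hN
  have h0 := hf.2 _ (isFlow_phaseFlow hU hy hyU.le hm hmn)
  rw [surplusNorm, surplusNorm, Real.sqrt_le_sqrt_iff (sum_nonneg fun _ _ => sq_nonneg _),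
    sum_sq_surplus_phaseFlow hmn] at h0
  have h3 : ∑ i, (surplus (fun k => phasePrice U m y k) f i -
      if i ∈ phaseAgents n m then 1 / (2 * (m : ℝ) + 1) else 0) ^ 2 ≤ 0 := by
    have h4 := mul_le_mul_of_nonneg_left h1 (by positivity : 0 ≤ 2 / (2 * (m : ℝ) + 1))
    have h5 : 2 / (2 * (m : ℝ) + 1) = 2 * (1 / (2 * (m : ℝ) + 1)) := by ring
    rw [mul_one] at h4
    linarith
  have h4 := (sum_eq_zero_iff_of_nonneg fun _ _ => sq_nonneg _).1
    (h3.antisymm (sum_nonneg fun _ _ => sq_nonneg _)) i (mem_univ i)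
  have h5 := sub_eq_zero.1 (pow_eq_zero_iff two_ne_zero |>.1 h4)
  simpa only [mem_phaseAgents] using h5

lemma IsBalancedFlow.surplusNorm_eq (hU : 1 ≤ U) (hm : 1 ≤ m) (hmn : 2 * m + 2 ≤ n) (hy : 1 ≤ y)
    (hyU : y < U) {f : Fin n → Fin n → ℝ}
    (hf : IsBalancedFlow (instanceI n U) (fun k => phasePrice U m y k) f) :
    surplusNorm (fun k => phasePrice U m y k) f = Real.sqrt (1 / (2 * (m : ℝ) + 1)) := by
  rw [surplusNorm, ← sum_sq_surplus_phaseFlow (U := U) (y := y) hmn]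
  congr 1
  refine sum_congr rfl fun i _ => ?_
  rw [hf.surplus_eq hU hm hmn hy hyU, surplus_phaseFlow hmn]

end BalancedFlows

/-! ### The high-surplus agents and the price update factor -/

section Iterations

variable {n U m : ℕ} {y : ℝ} {A : Algorithm} {f : Fin n → Fin n → ℝ}

lemma topAgents_phase (hU : 1 ≤ U) (hm : 1 ≤ m) (hmn : 2 * m + 2 ≤ n) (hy : 1 ≤ y)
    (hyU : y < U) (hf : IsBalancedFlow (instanceI n U) (fun k => phasePrice U m y k) f) :
    topAgents (fun k => phasePrice U m y k) f (1 / (2 * (m : ℝ) + 1)) = phaseAgents n m := by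
  have hs : (0 : ℝ) < 1 / (2 * (m : ℝ) + 1) := by positivity
  ext i
  simp only [topAgents, mem_filter, mem_univ, true_and, mem_phaseAgents,
    hf.surplus_eq hU hm hmn hy hyU]
  split_ifs with h
  · exact iff_of_true le_rfl h
  · exact iff_of_false hs.not_ge h

lemma isCut_phase_iff (hU : 1 ≤ U) (hm : 1 ≤ m) (hmn : 2 * m + 2 ≤ n) (hy : 1 ≤ y)
    (hyU : y < U) (hf : IsBalancedFlow (instanceI n U) (fun k => phasePrice U m y k) f) (θ : ℝ) :
    IsCut A (instanceI n U) (fun k => phasePrice U m y k) f θ ↔ θ = 1 / (2 * (m : ℝ) + 1) := by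
  have hs : (0 : ℝ) < 1 / (2 * (m : ℝ) + 1) := by positivity
  have hr := hf.surplus_eq hU hm hmn hy hyU
  constructor
  · rintro ⟨⟨i, hi⟩, ⟨k, hk⟩, -⟩
    rw [hr] at hi hk
    split_ifs at hi hk <;> linarith
  · rintro rfl
    have key : ∀ k, surplus (fun k => phasePrice U m y k) f k < 1 / (2 * (m : ℝ) + 1) →
        surplus (fun k => phasePrice U m y k) f k = 0 := by
      intro k hk
      rw [hr] at hk ⊢
      split_ifs at hk ⊢
      · exact absurd hk (lt_irrefl _)
      · rfl
    refine ⟨⟨⟨0, by omega⟩, by rw [hr, if_pos (by simp)]⟩,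
      ⟨⟨2 * m + 1, by omega⟩, by rwa [hr, if_neg (by simp)]⟩, ?_⟩
    cases A
    · intro k hk
      rw [key k hk, mul_zero]
      exact hs
    · intro k hk hk'
      rw [key k hk] at hk'
      have : (0 : ℝ) < 1 / (2 * (m : ℝ) + 1) / (1 + 1 / (n : ℝ)) := by positivity
      linarith

lemma isHighSurplusSet_phase_iff (hU : 1 ≤ U) (hm : 1 ≤ m) (hmn : 2 * m + 2 ≤ n) (hy : 1 ≤ y)
    (hyU : y < U) (hf : IsBalancedFlow (instanceI n U) (fun k => phasePrice U m y k) f)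
    (S : Finset (Fin n)) :
    IsHighSurplusSet A (instanceI n U) (fun k => phasePrice U m y k) f S ↔
      S = phaseAgents n m := by
  have hcut := isCut_phase_iff (A := A) hU hm hmn hy hyU hf
  have htop := topAgents_phase hU hm hmn hy hyU hf
  simp only [IsHighSurplusSet, hcut]
  constructor
  · rintro (⟨θ, hθ, rfl⟩ | ⟨h, -⟩)
    · rw [show θ = 1 / (2 * (m : ℝ) + 1) from hθ.1, htop]
    · exact absurd rfl (h _)
  · rintro rfl
    exact Or.inl ⟨_, ⟨rfl, fun t ht => ht.le⟩, htop.symm⟩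

lemma isType1_phase_iff (hU : 1 ≤ U) (hm : 1 ≤ m) (hmn : 2 * m + 2 ≤ n) (hy : 1 ≤ y)
    (hyU : y < U) (hf : IsBalancedFlow (instanceI n U) (fun k => phasePrice U m y k) f)
    (i : Fin n) :
    IsType1 (instanceI n U) (fun k => phasePrice U m y k) f (phaseAgents n m) i ↔
      i.val < 2 * m := by
  have hs : (0 : ℝ) < 1 / (2 * (m : ℝ) + 1) := by positivity
  rw [IsType1, nbhd_phaseAgents hU hm hmn hy hyU, mem_phaseAgents, ownedValue]
  constructor
  · rintro ⟨hi, h⟩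
    by_contra hi'
    rw [if_neg (by simpa using hi')] at h
    exact absurd h (sum_nonneg fun j _ => hf.1.nonneg i j).not_gt
  · intro hi
    refine ⟨hi.le, ?_⟩
    rw [if_pos (by simpa using hi), sum_phaseGoods_of_isFlow hm hmn hy hyU hf.1 hi.le]
    have h := hf.surplus_eq hU hm hmn hy hyU i
    rw [if_pos hi.le, surplus] at h
    linarith

lemma IsType2.val_eq (hU : 1 ≤ U) (hm : 1 ≤ m) (hmn : 2 * m + 2 ≤ n) (hy : 1 ≤ y)
    (hyU : y < U) (hf : IsBalancedFlow (instanceI n U) (fun k => phasePrice U m y k) f)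
    {i : Fin n}
    (h : IsType2 (instanceI n U) (fun k => phasePrice U m y k) f (phaseAgents n m) i) :
    i.val = 2 * m := by
  refine (mem_phaseAgents.1 h.1).antisymm (not_lt.1 fun hi => ?_)
  exact ((isType1_phase_iff hU hm hmn hy hyU hf i).2 hi).2.not_ge h.2

lemma not_isType3_phase (hU : 1 ≤ U) (hm : 1 ≤ m) (hmn : 2 * m + 2 ≤ n) (hy : 1 ≤ y)
    (hyU : y < U) (i : Fin n) :
    ¬ IsType3 (instanceI n U) (fun k => phasePrice U m y k) (phaseAgents n m) i := by
  rw [IsType3, nbhd_phaseAgents hU hm hmn hy hyU, mem_phaseAgents, mem_phaseGoods]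
  omega

/-- The value of `x_max` in phase `m`, where there are `2m` agents of type 1 and none of type 3. -/
noncomputable def phaseFactor (A : Algorithm) (n m : ℕ) : ℝ :=
  match A with
  | .DM => 1 + 1 / (R * (n : ℝ) ^ 3)
  | .DGM => 1 + 1 / (R * (2 * m : ℝ) * (n : ℝ) ^ 2)

lemma four_le_exp_one_sq : 4 ≤ Real.exp 1 ^ 2 := by
  have h : (2 : ℝ) ≤ Real.exp 1 := by
    have := Real.add_one_le_exp (1 : ℝ)
    linarith
  nlinarith

lemma one_le_R : 1 ≤ R := by
  have := four_le_exp_one_sq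
  unfold R
  linarith

lemma one_lt_phaseFactor (hm : 1 ≤ m) (hmn : 2 * m ≤ n) : 1 < phaseFactor A n m := by
  have hR := one_le_R
  have hm' : (0 : ℝ) < m := by exact_mod_cast hm
  have hn : (0 : ℝ) < n := by exact_mod_cast (by omega : 0 < n)
  have : 0 < R := by linarith
  cases A <;> simp only [phaseFactor, lt_add_iff_pos_right] <;> positivity

lemma phaseFactor_le (hm : 1 ≤ m) (hmn : 2 * m ≤ n) :
    phaseFactor A n m ≤ 1 + 1 / (R * (2 * m : ℝ) * (n : ℝ) ^ 2) := by
  have hR := one_le_R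
  have hm' : (0 : ℝ) < m := by exact_mod_cast hm
  have hn : (0 : ℝ) < n := by exact_mod_cast (by omega : 0 < n)
  have hmn' : 2 * (m : ℝ) ≤ n := by exact_mod_cast hmn
  have : 0 < R := by linarith
  cases A
  · rw [phaseFactor]
    have h : R * (2 * m : ℝ) * (n : ℝ) ^ 2 ≤ R * (n : ℝ) ^ 3 := by
      calc R * (2 * m : ℝ) * (n : ℝ) ^ 2 ≤ R * n * (n : ℝ) ^ 2 := by gcongr
        _ = R * (n : ℝ) ^ 3 := by ring
    gcongr
  · exact le_rfl

lemma xMax_phase (hU : 1 ≤ U) (hm : 1 ≤ m) (hmn : 2 * m + 2 ≤ n) (hy : 1 ≤ y)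
    (hyU : y < U) (hf : IsBalancedFlow (instanceI n U) (fun k => phasePrice U m y k) f) :
    xMax A (instanceI n U) (fun k => phasePrice U m y k) f (phaseAgents n m) =
      phaseFactor A n m := by
  classical
  cases A
  · rfl
  · have h : (univ.filter fun i => IsType1 (instanceI n U) (fun k => phasePrice U m y k) f
        (phaseAgents n m) i) = phaseGoods n m := by
      ext i
      simp only [mem_filter, mem_univ, true_and, mem_phaseGoods,
        isType1_phase_iff hU hm hmn hy hyU hf]
    simp only [xMax, phaseFactor]
    rw [if_neg fun ⟨i, hi⟩ => not_isType3_phase hU hm hmn hy hyU i hi]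
    have hc : (univ.filter fun i => IsType1 (instanceI n U) (fun k => phasePrice U m y k) f
        (phaseAgents n m) i).card = 2 * m := by rw [h, card_phaseGoods (by omega)]
    have hc' : ((univ.filter fun i => IsType1 (instanceI n U) (fun k => phasePrice U m y k) f
        (phaseAgents n m) i).card : ℝ) = 2 * m := by rw [hc]; push_cast; ring
    rw [← hc']

/-- The surplus of agent `2m` is zero after the price update only for a factor that is at least
`x_max`. -/
lemma phaseFactor_le_of_newSurplus_eq_zero (hU : 1 ≤ U) (hm : 1 ≤ m) (hmn : 2 * m + 2 ≤ n)
    (hy : 1 ≤ y) (hyU : y < U)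
    (hf : IsBalancedFlow (instanceI n U) (fun k => phasePrice U m y k) f) {i : Fin n}
    (hi : i.val = 2 * m) {x : ℝ}
    (hx : newSurplus (phaseGoods n m) (fun k => phasePrice U m y k) f x i = 0) :
    phaseFactor A n m ≤ x := by
  have h := hf.surplus_eq hU hm hmn hy hyU i
  have hmem : ∀ j, newFlow (phaseGoods n m) x f i j = x * f i j := by
    intro j
    rw [newFlow]
    split_ifs with hj
    · rfl
    · by_contra hne
      have hfij : f i j ≠ 0 := by
        rintro h0
        rw [h0, mul_zero] at hne
        exact hne rfl
      exact hj (mem_phaseGoods.2 ((hf.1.supported i j hfij).lt_of_le (by omega) hm hy hyU hi.le))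
  rw [newSurplus, surplus, newPrice, if_neg (by simp [hi]), hi, phasePrice_of_le le_rfl,
    sum_congr rfl fun j _ => hmem j, ← mul_sum] at hx
  rw [if_pos hi.le, surplus, hi, phasePrice_of_le le_rfl] at h
  have hm' : (0 : ℝ) < m := by exact_mod_cast hm
  have hout : ∑ j, f i j = 2 * (m : ℝ) / (2 * m + 1) := by
    have : ∑ j, f i j = 1 - 1 / (2 * (m : ℝ) + 1) := by linarith
    rw [this]
    field_simp
    ring
  have hx' : x = 1 + 1 / (2 * m : ℝ) := by
    rw [hout] at hx
    field_simp at hx ⊢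
    linarith
  rw [hx']
  refine (phaseFactor_le hm (by omega)).trans ?_
  have hR := one_le_R
  have hn : (1 : ℝ) ≤ (n : ℝ) ^ 2 := one_le_pow₀ (by exact_mod_cast (by omega : 1 ≤ n))
  have h1 : 2 * (m : ℝ) ≤ R * (2 * m) * (n : ℝ) ^ 2 := by
    calc 2 * (m : ℝ) = 1 * (2 * m) * 1 := by ring
      _ ≤ R * (2 * m) * (n : ℝ) ^ 2 := by gcongr
  gcongr

/-- In phase `m` the price update is limited only by `x_max` and by the new equality edges from
agents `2m - 1` and `2m` that end the phase. -/
lemma isLeast_candidateFactor (hU : 1 ≤ U) (hm : 1 ≤ m) (hmn : 2 * m + 2 ≤ n) (hy : 1 ≤ y)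
    (hyU : y < U) (hf : IsBalancedFlow (instanceI n U) (fun k => phasePrice U m y k) f) :
    IsLeast {x | IsCandidateFactor A (instanceI n U) (fun k => phasePrice U m y k) f
      (phaseAgents n m) x} (min (phaseFactor A n m) (U / y)) := by
  have hN := nbhd_phaseAgents hU hm hmn hy hyU
  have hM := xMax_phase (A := A) hU hm hmn hy hyU hf
  constructor
  · rcases min_choice (phaseFactor A n m) (U / y) with h | h
    · rw [h]
      exact Or.inl hM.symm
    · rw [h]
      -- The edge from agent `2m` to good `2m + 1` appears when `y` reaches `U`.
      have hedge : ((⟨2 * m - 1, by omega⟩ : Fin n).val) + 1 =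
          (⟨2 * m, by omega⟩ : Fin n).val := by simp only; omega
      refine Or.inr (Or.inl ⟨⟨2 * m, by omega⟩, by simp, ⟨2 * m - 1, by omega⟩,
        ⟨2 * m + 1, by omega⟩, isEdge_pred hU hy hyU.le hedge, ?_, ?_, ?_⟩)
      · rw [hN]
        simp
      · rw [instanceI_succ (by simp only; omega) rfl]
        exact one_pos
      · beta_reduce
        rw [instanceI_pred hedge, instanceI_succ (by simp only; omega) rfl,
          phasePrice_of_last (j := 2 * m - 1) (by omega) (by omega),
          phasePrice_of_le (by simp), div_one, mul_one]
  · rintro x (hx | ⟨i, hi, j, k, hij, hk, hik, hx⟩ | ⟨-, hx⟩)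
    · rw [hx, hM]
      exact min_le_left _ _
    · -- Only the agents `2m - 1` and `2m` have utility for a good outside of `Γ(S)`.
      refine (min_le_right _ _).trans ?_
      rw [mem_phaseAgents] at hi
      rw [hN, mem_phaseGoods] at hk
      have hj := hij.cases (by omega) hy hyU
      obtain ⟨h1, h2, h3⟩ : j.val + 1 = i.val ∧ i.val ≠ 0 ∧ k.val = i.val + 1 := by
        rcases instanceI_pos_cases hik with h | h | h <;> omega
      beta_reduce at hx
      rw [hx, instanceI_pred h1, instanceI_succ h2 h3, phasePrice_of_le (by omega : 2 * m ≤ k.val),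
        phasePrice_of_last (by omega : 2 * m ≤ j.val + 2) (by omega)]
      simp
    · refine (min_le_left _ _).trans ?_
      rw [hN] at hx
      rcases hx with ⟨i, j, -, hj, -⟩ | ⟨i, j, hi, hj, hx⟩ | ⟨i, j, -, hj, -⟩ | ⟨i, hi, hx⟩
      · exact absurd hj (not_isType3_phase hU hm hmn hy hyU j)
      · -- A type-4b agent has surplus zero before and after the update.
        refine phaseFactor_le_of_newSurplus_eq_zero hU hm hmn hy hyU hf
          (hi.val_eq hU hm hmn hy hyU hf) (hx.trans ?_)
        have hj' : 2 * m < j.val := by simpa using hj.1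
        have hflow : ∀ l, newFlow (phaseGoods n m) x f j l = f j l := by
          intro l
          rw [newFlow]
          split_ifs with hl
          · by_contra hne
            have hfjl : f j l ≠ 0 := by
              rintro h0
              rw [h0, mul_zero] at hne
              exact hne rfl
            have := (hf.1.supported j l hfjl).le_of_lt (by omega) hy hyU hj'
            rw [mem_phaseGoods] at hl
            omega
          · rfl
        have hs := hf.surplus_eq hU hm hmn hy hyU j
        rw [if_neg hj'.not_ge] at hs
        rw [newSurplus, surplus, sum_congr rfl fun l _ => hflow l, newPrice,
          if_neg (by simp; omega)]
        exact hs
      · exact absurd hj (not_isType3_phase hU hm hmn hy hyU j)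
      · exact phaseFactor_le_of_newSurplus_eq_zero hU hm hmn hy hyU hf
          (hi.val_eq hU hm hmn hy hyU hf) hx

lemma newPrice_phaseGoods (x : ℝ) :
    newPrice (phaseGoods n m) x (fun k => phasePrice U m y k) =
      fun k : Fin n => phasePrice U m (x * y) k := by
  funext k
  simp only [newPrice, mem_phaseGoods, phasePrice]
  split_ifs <;> ring

end Iterations

/-! ### The final prices -/

section Equilibrium

variable {n U m : ℕ}

/-- In the flow that clears the market at the final prices, the agents `2l` and `2l + 1` buy each
other's goods, which have the same price. -/
lemma exists_isFlow_final (hU : 1 ≤ U) (hmn : 2 * m = n) :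
    ∃ f, IsFlow (instanceI n U) (fun k => phasePrice U m 1 k) f ∧
      surplusNorm (fun k => phasePrice U m 1 k) f = 0 := by
  have hU' : (1 : ℝ) ≤ U := by exact_mod_cast hU
  have hpos := fun a => (phasePrice_pos (U := U) (m := m) (y := 1) hU le_rfl a).le
  set b : ℕ → ℝ := fun i => if i % 2 = 0 then 0 else phasePrice U m 1 i with hb
  set c : ℕ → ℝ := fun i => if i % 2 = 0 then phasePrice U m 1 i else 0 with hc
  have hrow : ∀ i : Fin n, ∑ j, pathFlow n b c i j = phasePrice U m 1 i := by
    intro i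
    rw [sum_pathFlow_row]
    by_cases hi : i.val % 2 = 0
    · simp [hb, hc, hi, show i.val + 1 < n by omega]
    · simp [hb, hc, hi]
  refine ⟨pathFlow n b c, ⟨?_, ?_, fun i => (hrow i).le, ?_⟩, ?_⟩
  · intro i j
    have h1 : 0 ≤ b i := by simp only [hb]; split_ifs; exacts [le_rfl, hpos _]
    have h2 : 0 ≤ c i := by simp only [hc]; split_ifs; exacts [hpos _, le_rfl]
    unfold pathFlow
    split_ifs <;> linarith
  · intro i j hij
    unfold pathFlow at hij
    by_cases h1 : j.val = i.val - 1
    · by_cases hi : i.val = 0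
      · exact isEdge_of_zero hU le_rfl hi (by omega)
      · exact isEdge_pred hU le_rfl hU' (by omega)
    · by_cases h2 : j.val = i.val + 1
      · by_cases hi : i.val = 0
        · exact isEdge_of_zero hU le_rfl hi (by omega)
        · exact isEdge_succ hU le_rfl hi h2 (by omega)
      · rw [if_neg h1, if_neg h2, add_zero] at hij
        exact absurd rfl hij
  · intro j
    rw [sum_pathFlow_col]
    obtain ⟨l, hl | hl⟩ := Nat.even_or_odd' j.val
    · have h := phasePrice_two_mul_add_one (U := U) (m := m) (y := 1) l
      rw [if_pos (by omega), hl]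
      by_cases hl0 : l = 0
      · subst hl0
        simpa [hb] using h.le
      · rw [if_neg (by omega)]
        simp [hb, hc, show (2 * l + 1) % 2 = 1 by omega, show (2 * l - 1) % 2 = 1 by omega, h]
    · have h := phasePrice_two_mul_add_one (U := U) (m := m) (y := 1) l
      rw [if_neg (by omega : ¬ j.val = 0), hl, h]
      simp [hb, hc, show (2 * l + 1 + 1) % 2 = 0 by omega]
  · rw [surplusNorm]
    simp [surplus, hrow]

lemma IsBalancedFlow.surplusNorm_final (hU : 1 ≤ U) (hmn : 2 * m = n)
    {f : Fin n → Fin n → ℝ}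
    (hf : IsBalancedFlow (instanceI n U) (fun k => phasePrice U m 1 k) f) :
    surplusNorm (fun k => phasePrice U m 1 k) f = 0 := by
  obtain ⟨g, hg, hg0⟩ := exists_isFlow_final hU hmn
  exact ((hf.2 g hg).trans hg0.le).antisymm (Real.sqrt_nonneg _)

end Equilibrium

/-! ### Runs and the number of iterations -/

section Runs

variable {n U m : ℕ} {y ε : ℝ} {A : Algorithm}

/-- A lower bound for the number of iterations needed to get to the prices `phasePrice U m y`: phase
`l` contributes `2 * l * R * n ^ 2` per unit of `log y`, and `∑ l < m, 2 * l = m * (m - 1)`. -/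
noncomputable def phaseProgress (n U m : ℕ) (y : ℝ) : ℝ :=
  R * (n : ℝ) ^ 2 * (m * (m - 1) * Real.log U + 2 * m * Real.log y)

lemma phaseProgress_succ_one : phaseProgress n U (m + 1) 1 = phaseProgress n U m U := by
  unfold phaseProgress
  push_cast
  rw [Real.log_one]
  ring

lemma phaseProgress_mul_le (hm : 1 ≤ m) (hmn : 2 * m ≤ n) (hy : 0 < y) {x : ℝ} (hx : 0 < x)
    (hx' : x ≤ phaseFactor A n m) :
    phaseProgress n U m (x * y) ≤ phaseProgress n U m y + 1 := by
  have hR : 0 < R := by linarith [one_le_R]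
  have hm' : (0 : ℝ) < m := by exact_mod_cast hm
  have hn : (0 : ℝ) < n := by exact_mod_cast (by omega : 0 < n)
  have h1 : Real.log x ≤ 1 / (R * (2 * m : ℝ) * (n : ℝ) ^ 2) := by
    have := Real.log_le_sub_one_of_pos hx
    have := phaseFactor_le (A := A) hm hmn
    linarith
  have h2 : R * (2 * m : ℝ) * (n : ℝ) ^ 2 * Real.log x ≤ 1 := by
    rw [le_div_iff₀ (by positivity)] at h1
    linarith
  unfold phaseProgress
  rw [Real.log_mul hx.ne' hy.ne']
  linarith

lemma one_lt_min_phaseFactor (hm : 1 ≤ m) (hmn : 2 * m ≤ n) (hy : 1 ≤ y) (hyU : y < U) :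
    1 < min (phaseFactor A n m) (U / y) :=
  lt_min (one_lt_phaseFactor hm hmn) (by rwa [one_lt_div (by linarith)])

/-- All prices that occur in a run are those of some phase or the final ones. -/
lemma Reaches.exists_phase (hn : Even n) (hn4 : 4 ≤ n) (hU : 1 ≤ U) (hε : 0 < ε) {t : ℕ}
    {p : Fin n → ℝ} (h : Reaches A (instanceI n U) ε t p) :
    ∃ (m : ℕ) (y : ℝ), 1 ≤ m ∧ 1 ≤ y ∧ ((2 * m + 2 ≤ n ∧ y < U) ∨ (2 * m = n ∧ y = 1)) ∧
      (p = fun k : Fin n => phasePrice U m y k) ∧ phaseProgress n U m y ≤ t := by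
  obtain ⟨k, hk⟩ := hn
  induction h with
  | init =>
    rcases hU.eq_or_lt with rfl | hU
    -- For `U = 1` the initial prices are already the final ones.
    · refine ⟨k, 1, by omega, le_rfl, Or.inr ⟨by omega, rfl⟩, ?_, ?_⟩
      · funext j
        simp [phasePrice]
      · simp [phaseProgress]
    · refine ⟨1, 1, le_rfl, le_rfl, Or.inl ⟨by omega, by exact_mod_cast hU⟩, ?_, ?_⟩
      · funext j
        rw [phasePrice_one_one]
      · simp [phaseProgress]
  | @iterate t p h f S x hf guard hS hx ih =>
    obtain ⟨m, y, hm, hy, hcase, rfl, hprog⟩ := ih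
    rcases hcase with ⟨hmn, hyU⟩ | ⟨hmn, rfl⟩
    · rw [isHighSurplusSet_phase_iff hU hm hmn hy hyU hf] at hS
      subst hS
      have hxeq := hx.unique (isLeast_candidateFactor hU hm hmn hy hyU hf)
      have hx1 : 1 < x := hxeq ▸ one_lt_min_phaseFactor hm (by omega) hy hyU
      have hxA : x ≤ phaseFactor A n m := hxeq ▸ min_le_left _ _
      have hxU : x * y ≤ U := by
        rw [← le_div_iff₀ (by linarith)]
        exact hxeq ▸ min_le_right _ _
      have hp : phaseProgress n U m (x * y) ≤ (t + 1 : ℕ) := by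
        have := phaseProgress_mul_le (U := U) hm (by omega) (by linarith : 0 < y)
          (by linarith : 0 < x) hxA
        push_cast
        linarith
      rw [nbhd_phaseAgents hU hm hmn hy hyU, newPrice_phaseGoods]
      rcases hxU.lt_or_eq with hlt | heq
      · exact ⟨m, x * y, hm, one_le_mul_of_one_le_of_one_le hx1.le hy, Or.inl ⟨hmn, hlt⟩, rfl, hp⟩
      · refine ⟨m + 1, 1, by omega, le_rfl, ?_, ?_, ?_⟩
        · by_cases hmn' : 2 * (m + 1) = n
          · exact Or.inr ⟨hmn', rfl⟩
          · exact Or.inl ⟨by omega, by linarith⟩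
        · funext j
          rw [heq, phasePrice_succ]
        · rwa [phaseProgress_succ_one, ← heq]
    · rw [hf.surplusNorm_final hU hmn] at guard
      exact absurd guard hε.not_gt

lemma lt_surplusNorm_of_phase (hU : 1 ≤ U) (hm : 1 ≤ m) (hmn : 2 * m + 2 ≤ n) (hy : 1 ≤ y)
    (hyU : y < U) (hε : ε < 1 / n) {f : Fin n → Fin n → ℝ}
    (hf : IsBalancedFlow (instanceI n U) (fun k => phasePrice U m y k) f) :
    ε < surplusNorm (fun k => phasePrice U m y k) f := by
  rw [hf.surplusNorm_eq hU hm hmn hy hyU]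
  refine hε.trans_le (Real.le_sqrt_of_sq_le ?_)
  have hmn' : 2 * (m : ℝ) + 2 ≤ n := by exact_mod_cast hmn
  have hm' : (0 : ℝ) ≤ m := by positivity
  rw [div_pow, one_pow]
  refine one_div_le_one_div_of_le (by positivity) ?_
  nlinarith

lemma Reaches.step_of_phase (hU : 1 ≤ U) (hm : 1 ≤ m) (hmn : 2 * m + 2 ≤ n) (hy : 1 ≤ y)
    (hyU : y < U) (hε : ε < 1 / n) {t : ℕ}
    (h : Reaches A (instanceI n U) ε t (fun k => phasePrice U m y k)) :
    Reaches A (instanceI n U) ε (t + 1)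
      (fun k => phasePrice U m (min (phaseFactor A n m) (U / y) * y) k) := by
  have hf := isBalancedFlow_phaseFlow hU hm hmn hy hyU
  have := h.iterate _ (phaseAgents n m) _ hf (lt_surplusNorm_of_phase hU hm hmn hy hyU hε hf)
    ((isHighSurplusSet_phase_iff hU hm hmn hy hyU hf _).2 rfl)
    (isLeast_candidateFactor hU hm hmn hy hyU hf)
  rwa [nbhd_phaseAgents hU hm hmn hy hyU, newPrice_phaseGoods] at this

/-- Every phase that is entered is completed, since `y` is multiplied by the constant
`phaseFactor A n m > 1` until it reaches `U`. -/
lemma Reaches.exists_phase_end (hU : 1 ≤ U) (hm : 1 ≤ m) (hmn : 2 * m + 2 ≤ n) (hε : ε < 1 / n)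
    {t : ℕ} (h : Reaches A (instanceI n U) ε t (fun k => phasePrice U m 1 k)) :
    ∃ t', Reaches A (instanceI n U) ε t' (fun k => phasePrice U m U k) := by
  have hq := one_lt_phaseFactor (A := A) hm (by omega : 2 * m ≤ n)
  have key : ∀ (N t : ℕ) (y : ℝ), 1 ≤ y → y ≤ U → U ≤ phaseFactor A n m ^ N * y →
      Reaches A (instanceI n U) ε t (fun k => phasePrice U m y k) →
      ∃ t', Reaches A (instanceI n U) ε t' (fun k => phasePrice U m U k) := by
    intro N
    induction N with
    | zero =>
      intro t y _ hyU hUy h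
      obtain rfl : y = U := hyU.antisymm (by simpa using hUy)
      exact ⟨t, h⟩
    | succ N ih =>
      intro t y hy hyU hUy h
      rcases hyU.eq_or_lt with rfl | hyU
      · exact ⟨t, h⟩
      · have hstep := h.step_of_phase hU hm hmn hy hyU hε
        rcases le_total (phaseFactor A n m) (U / y) with hle | hle
        · rw [min_eq_left hle] at hstep
          refine ih _ _ (one_le_mul_of_one_le_of_one_le hq.le hy) ?_ ?_ hstep
          · rwa [le_div_iff₀ (by linarith)] at hle
          · rwa [pow_succ, mul_assoc] at hUy
        · rw [min_eq_right hle, div_mul_cancel₀ _ (by linarith)] at hstep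
          exact ⟨_, hstep⟩
  obtain ⟨N, hN⟩ := pow_unbounded_of_one_lt (U : ℝ) hq
  exact key N t 1 le_rfl (by exact_mod_cast hU) (by rw [mul_one]; exact hN.le) h

lemma exists_reaches_phase (hU : 1 ≤ U) (hε : ε < 1 / n) (hm : 1 ≤ m) (hmn : 2 * m ≤ n) :
    ∃ t, Reaches A (instanceI n U) ε t (fun k => phasePrice U m 1 k) := by
  induction m, hm using Nat.le_induction with
  | base =>
    refine ⟨0, ?_⟩
    simp only [phasePrice_one_one]
    exact Reaches.init
  | succ m hm ih =>
    obtain ⟨t, ht⟩ := ih (by omega)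
    obtain ⟨t', ht'⟩ := ht.exists_phase_end hU hm (by omega) hε
    exact ⟨t', by simpa only [phasePrice_succ] using ht'⟩

lemma exists_haltsAfter (hn : Even n) (hn4 : 4 ≤ n) (hU : 1 ≤ U) (hε0 : 0 < ε) (hε : ε < 1 / n) :
    ∃ T, HaltsAfter A (instanceI n U) ε T := by
  obtain ⟨m, hm⟩ := hn
  obtain ⟨t, ht⟩ := exists_reaches_phase (A := A) hU hε (by omega : 1 ≤ m) (by omega : 2 * m ≤ n)
  obtain ⟨f, hf, hf0⟩ := exists_isFlow_final hU (by omega : 2 * m = n)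
  refine ⟨t, _, f, ht, ⟨hf, fun g _ => ?_⟩, hf0.trans_le hε0.le⟩
  rw [hf0]
  exact Real.sqrt_nonneg _

lemma HaltsAfter.le (hn : Even n) (hn4 : 4 ≤ n) (hU : 1 ≤ U) (hε0 : 0 < ε) (hε : ε < 1 / n)
    {T : ℕ} (h : HaltsAfter A (instanceI n U) ε T) :
    Real.exp 1 ^ 2 * ((n : ℝ) ^ 4 * Real.log U) ≤ T := by
  obtain ⟨p, f, hp, hf, hfε⟩ := h
  obtain ⟨m, y, hm, hy, hcase, rfl, hprog⟩ := hp.exists_phase hn hn4 hU hε0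
  rcases hcase with ⟨hmn, hyU⟩ | ⟨hmn, rfl⟩
  · exact absurd hfε (lt_surplusNorm_of_phase hU hm hmn hy hyU hε hf).not_ge
  · refine le_trans ?_ hprog
    have hn' : (n : ℝ) = 2 * m := by exact_mod_cast hmn.symm
    have hm2 : (2 : ℝ) ≤ m := by exact_mod_cast (by omega : 2 ≤ m)
    have hlog : 0 ≤ Real.log U := Real.log_nonneg (by exact_mod_cast hU)
    rw [phaseProgress, Real.log_one, mul_zero, add_zero, R, hn']
    -- Since `n = 2m`, the claim is `16 m ^ 4 ≤ 32 m ^ 3 * (m - 1)`, that is, `m ≥ 2`.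
    have h1 : 0 ≤ Real.exp 1 ^ 2 * Real.log U * (16 * (m : ℝ) ^ 3 * (m - 2)) := by
      have : (0 : ℝ) ≤ m - 2 := by linarith
      positivity
    linarith

end Runs

lemma log_mul_div_log_le {a b : ℝ} (ha : 4 ≤ a) (hb : 2 ≤ b) :
    Real.log (a * b) / Real.log a ≤ 4 * Real.log b := by
  have hb' : 1 / 2 ≤ Real.log b := by
    have := Real.one_sub_inv_le_log_of_pos (by linarith : 0 < b)
    have : b⁻¹ ≤ 2⁻¹ := inv_anti₀ two_pos hb
    linarith
  have ha' : 1 / 2 ≤ Real.log a := by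
    have := Real.one_sub_inv_le_log_of_pos (by linarith : 0 < a)
    have : a⁻¹ ≤ 4⁻¹ := inv_anti₀ four_pos ha
    linarith
  rw [Real.log_mul (by linarith) (by linarith), div_le_iff₀ (by linarith)]
  nlinarith

lemma threshold_lt_one_div {n U : ℕ} (hn : 4 ≤ n) (hU : 1 ≤ U) :
    1 / (8 * (n : ℝ) ^ (4 * n) * (U : ℝ) ^ (3 * n)) < 1 / n := by
  have hn' : (4 : ℝ) ≤ n := by exact_mod_cast hn
  have h1 : (n : ℝ) ≤ (n : ℝ) ^ (4 * n) := le_self_pow₀ (by linarith) (by omega)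
  have h2 : 1 ≤ (U : ℝ) ^ (3 * n) := one_le_pow₀ (by exact_mod_cast hU)
  refine one_div_lt_one_div_of_lt (by linarith) ?_
  nlinarith

end ArrowDebreu

theorem mainTheorem6 :
    ∃ c : ℝ, 0 < c ∧
      ∀ (n U : ℕ) (ε : ℝ), Even n → 4 ≤ n → 1 ≤ U →
        0 < ε → ε ≤ 1 / (8 * (n : ℝ) ^ (4 * n) * (U : ℝ) ^ (3 * n)) →
        ∀ A : ArrowDebreu.Algorithm,
          (∃ T : ℕ, ArrowDebreu.HaltsAfter A (ArrowDebreu.instanceI n U) ε T) ∧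
          ∀ T : ℕ, ArrowDebreu.HaltsAfter A (ArrowDebreu.instanceI n U) ε T →
            c * ((n : ℝ) ^ 4 * Real.log U) ≤ T ∧
            (2 ≤ U → c * ((n : ℝ) ^ 4 * Real.log (n * U) / Real.log n) ≤ T) := by
  have hexp := ArrowDebreu.four_le_exp_one_sq
  refine ⟨1, one_pos, fun n U ε hn hn4 hU hε0 hε A => ?_⟩
  have hε' := hε.trans_lt (ArrowDebreu.threshold_lt_one_div hn4 hU)
  refine ⟨ArrowDebreu.exists_haltsAfter hn hn4 hU hε0 hε', fun T hT => ?_⟩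
  have hT' := hT.le hn hn4 hU hε0 hε'
  have hlog : 0 ≤ (n : ℝ) ^ 4 * Real.log U :=
    mul_nonneg (by positivity) (Real.log_nonneg (by exact_mod_cast hU))
  have h4 : 4 * ((n : ℝ) ^ 4 * Real.log U) ≤ T :=
    (mul_le_mul_of_nonneg_right hexp hlog).trans hT'
  refine ⟨by linarith, fun hU2 => ?_⟩
  have h := mul_le_mul_of_nonneg_left
    (ArrowDebreu.log_mul_div_log_le (a := n) (b := U) (by exact_mod_cast hn4)
      (by exact_mod_cast hU2)) (by positivity : 0 ≤ (n : ℝ) ^ 4)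
  rw [one_mul, mul_div_assoc]
  linarith
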